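/- Throughout, rings are associative but need not have an identity. For a groupoid $G$ with object set $\mathrm{ob}(G)$, write $d(g)$ and $c(g)$ for the domain and codomain of a morphism $g$, identify an object with its identity morphism, and write $gh$ for the composite when $d(g)=c(h)$. A *partial action* $\alpha=\{\alpha_g:R_{g^{-1}}\to R_g\}_{g\in \mathrm{mor}(G)}$ of $G$ on a ring $R$ consists of ideals $R_e$ of $R$ ($e\in\mathrm{ob}(G)$) with $R=\bigoplus_{e\in\mathrm{ob}(G)}R_e$, ideals $R_g$ of $R_{c(g)}$, and ring isomorphisms $\alpha_g:R_{g^{-1}}\to R_g$ such that $\alpha_e=\mathrm{id}_{R_e}$ for every object $e$, and, whenever $d(g)=c(h)$, $\alpha_h^{-1}(R_h\cap R_{g^{-1}})\subseteq R_{(gh)^{-1}}$ and $\alpha_g(\alpha_h(x))=\alpha_{gh}(x)$ for all $x\in\alpha_h^{-1}(R_h\cap R_{g^{-1}})$. It is *unital* if every non-zero $R_g$ has a multiplicative identity, and *global* if $\alpha_{gh}=\alpha_g\alpha_h$ (as partial maps) whenever $d(g)=c(h)$. It is of *finite type* if for every $e\in\mathrm{ob}(G)$ there are finitely many morphisms $g_1,\dots,g_n$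 with codomain $e$ such that $R_{c(g)}=\sum_{i=1}^n R_{gg_i}$ for every morphism $g$ with domain $e$. A global action $\beta=\{\beta_g:T_{g^{-1}}\to T_g\}$ of $G$ on a ring $T=\bigoplus_{e\in\mathrm{ob}(G)}T_e$ is a *globalization* of $\alpha$ if there are injective ring homomorphisms $\psi_e:R_e\to T_e$ ($e\in\mathrm{ob}(G)$) such that each $\psi_e(R_e)$ is an ideal of $T_e$ and, for every morphism $g$: $\psi_{c(g)}(R_g)=\psi_{c(g)}(R_{c(g)})\cap\beta_g(\psi_{d(g)}(R_{d(g)}))$; $\beta_g(\psi_{d(g)}(a))=\psi_{c(g)}(\alpha_g(a))$ for all $a\in R_{g^{-1}}$; and $T_g=\sum_{c(h)=c(g)}\beta_h(\psi_{d(h)}(R_{d(h)}))$. A ring is *left (right) noetherian*, respectively *artinian*, if its left (right) ideals (additive subgroups closed under left (right) multiplication by the ring) satisfy the ascending, respectively descending, chain condition. **Corollary.** Let $G$ be a groupoid with $\mathrm{ob}(G)$ finite, let $\alpha$ be a unital partial action of $G$ on a ring $R$, and let $\beta$, acting on the ring $T$, be a globalization of $\alpha$. Then each of the following holds: 1. $T$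 is right noetherian if and only if $R$ is right noetherian and $\alpha$ is of finite type; 2. $T$ is left noetherian if and only if $R$ is left noetherian and $\alpha$ is of finite type; 3. $T$ is right artinian if and only if $R$ is right artinian and $\alpha$ is of finite type; 4. $T$ is left artinian if and only if $R$ is left artinian and $\alpha$ is of finite type. -/

import Mathlib

open CategoryTheory

universe v u w w'

/-! ### Chain conditions on (not necessarily unital) rings -/

section ChainConditions

variable (R : Type w) [NonUnitalRing R]

/-- Left ideals: additive subgroups `N` with `r * n ∈ N` for all `r : R`, `n ∈ N`; these are the
left submodules of `R` over itself. They are ordered by inclusion. -/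
abbrev NULeftIdeal : Type w :=
  {N : AddSubgroup R // ∀ r : R, ∀ n ∈ N, r * n ∈ N}

/-- Right ideals, ordered by inclusion. -/
abbrev NURightIdeal : Type w :=
  {N : AddSubgroup R // ∀ r : R, ∀ n ∈ N, n * r ∈ N}

/-- Ascending chain condition on left ideals. -/
def IsLeftNoetherian : Prop := WellFoundedGT (NULeftIdeal R)

/-- Ascending chain condition on right ideals. -/
def IsRightNoetherian : Prop := WellFoundedGT (NURightIdeal R)

/-- Descending chain condition on left ideals. -/
def IsLeftArtinian : Prop := WellFoundedLT (NULeftIdeal R)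

/-- Descending chain condition on right ideals. -/
def IsRightArtinian : Prop := WellFoundedLT (NURightIdeal R)

end ChainConditions

/-! ### Partial groupoid actions -/

open Classical in
/-- A partial action of a groupoid `G` on an associative, not necessarily unital ring `R`, with
`R` the direct sum of the ideals attached to the objects.

For `g : e ⟶ f` the domain is `d(g) = e` and the codomain is `c(g) = f`, and the product `gh` of
the mathematical notation is `h ≫ g`. `A.ideal g` is `R_g` and `A.map g` is
`α_g : R_{g⁻¹} → R_g`. -/
structure PartialGroupoidAction (G : Type u) [Groupoid.{v} G] (R : Type w) [NonUnitalRing R] where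
  /-- `R_g` -/
  ideal : ∀ {e f : G}, (e ⟶ f) → NonUnitalSubring R
  /-- `R_g` is contained in `R_{c(g)}` ... -/
  ideal_le : ∀ {e f : G} (g : e ⟶ f), ideal g ≤ ideal (𝟙 f)
  /-- ... and is a two-sided ideal of it. -/
  ideal_mul_mem : ∀ {e f : G} (g : e ⟶ f), ∀ r ∈ ideal (𝟙 f), ∀ a ∈ ideal g,
    r * a ∈ ideal g ∧ a * r ∈ ideal g
  /-- `R_e` is a two-sided ideal of `R`. -/
  ideal_id_mul_mem : ∀ (e : G) (r : R), ∀ a ∈ ideal (𝟙 e),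
    r * a ∈ ideal (𝟙 e) ∧ a * r ∈ ideal (𝟙 e)
  /-- `α_g` -/
  map : ∀ {e f : G} (g : e ⟶ f), ideal (Groupoid.inv g) ≃+* ideal g
  /-- `α_e` is the identity of `R_e`. -/
  map_id : ∀ (e : G) (x : ideal (Groupoid.inv (𝟙 e))), (map (𝟙 e) x : R) = x
  /-- `α_h⁻¹(R_h ∩ R_{g⁻¹}) ⊆ R_{(gh)⁻¹}` -/
  mem_of_map_mem : ∀ {d e f : G} (h : d ⟶ e) (g : e ⟶ f) (x : ideal (Groupoid.inv h)),
    (map h x : R) ∈ ideal (Groupoid.inv g) → (x : R) ∈ ideal (Groupoid.inv (h ≫ g))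
  /-- `α_g (α_h x) = α_{gh} x` for `x ∈ α_h⁻¹(R_h ∩ R_{g⁻¹})` -/
  map_map : ∀ {d e f : G} (h : d ⟶ e) (g : e ⟶ f) (x : ideal (Groupoid.inv h))
    (hx : (map h x : R) ∈ ideal (Groupoid.inv g)),
    (map g ⟨map h x, hx⟩ : R) = map (h ≫ g) ⟨x, mem_of_map_mem h g x hx⟩
  /-- `R = ⨁ e, R_e` -/
  isInternal : DirectSum.IsInternal fun e : G => ideal (𝟙 e)

namespace PartialGroupoidAction

variable {G : Type u} [Groupoid.{v} G] {R : Type w} [NonUnitalRing R]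
  {T : Type w'} [NonUnitalRing T]

/-- Every non-zero `R_g` has a multiplicative identity. -/
def IsUnital (α : PartialGroupoidAction G R) : Prop :=
  ∀ {e f : G} (g : e ⟶ f), α.ideal g ≠ ⊥ →
    ∃ i ∈ α.ideal g, ∀ x ∈ α.ideal g, i * x = x ∧ x * i = x

/-- `α_{gh} = α_g α_h` as partial maps, for all composable `g, h`: every `x` in the domain of
`α_{gh}` is in the domain of `α_g α_h`, with the same image. (The domain of `α_g α_h` is contained
in that of `α_{gh}` for every partial action.) -/
def IsGlobal (α : PartialGroupoidAction G R) : Prop :=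
  ∀ {d e f : G} (h : d ⟶ e) (g : e ⟶ f) (x : α.ideal (Groupoid.inv (h ≫ g))),
    ∃ (hx : (x : R) ∈ α.ideal (Groupoid.inv h))
      (hy : (α.map h ⟨x, hx⟩ : R) ∈ α.ideal (Groupoid.inv g)),
      (α.map g ⟨α.map h ⟨x, hx⟩, hy⟩ : R) = α.map (h ≫ g) x

/-- For every `e` there are finitely many `g₁, …, gₙ` with codomain `e` such that
`R_{c(g)} = ∑ i, R_{g gᵢ}` (sum of additive subgroups) for every `g` with domain `e`. -/
def IsOfFiniteType (α : PartialGroupoidAction G R) : Prop :=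
  ∀ e : G, ∃ s : Finset (Σ d : G, (d ⟶ e)), ∀ {f : G} (g : e ⟶ f),
    (α.ideal (𝟙 f)).toAddSubgroup = ⨆ p ∈ s, (α.ideal (p.2 ≫ g)).toAddSubgroup

theorem IsGlobal.ideal_id_le {β : PartialGroupoidAction G T} (hβ : β.IsGlobal) {e f : G}
    (g : e ⟶ f) : β.ideal (𝟙 e) ≤ β.ideal (Groupoid.inv g) := by
  intro x hx
  have h1 : Groupoid.inv (g ≫ Groupoid.inv g) = 𝟙 e := by simp
  exact (hβ g (Groupoid.inv g) ⟨x, by rw [h1]; exact hx⟩).1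

/-- For a global action, `T_{g⁻¹} = T_{d(g)}`; this is `β_g` as a map `T_{d(g)} → T`. -/
def IsGlobal.hom {β : PartialGroupoidAction G T} (hβ : β.IsGlobal) {e f : G} (g : e ⟶ f) :
    β.ideal (𝟙 e) →ₙ+* T :=
  ((NonUnitalSubringClass.subtype (β.ideal g)).comp
    (β.map g : β.ideal (Groupoid.inv g) →ₙ+* β.ideal g)).comp
      (NonUnitalSubring.inclusion (hβ.ideal_id_le g))

/-- The conditions that make the maps `ψ_e : R_e → T_e` exhibit the global action `β` as a
globalization of `α`. -/
structure IsGlobalizationVia (α : PartialGroupoidAction G R) (β : PartialGroupoidAction G T)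
    (hβ : β.IsGlobal) (ψ : ∀ e : G, α.ideal (𝟙 e) →ₙ+* β.ideal (𝟙 e)) : Prop where
  injective : ∀ e : G, Function.Injective (ψ e)
  /-- `ψ_e(R_e)` is a two-sided ideal of `T_e`. -/
  range_ideal : ∀ (e : G) (t : β.ideal (𝟙 e)), ∀ a ∈ (ψ e).range,
    t * a ∈ (ψ e).range ∧ a * t ∈ (ψ e).range
  /-- `ψ_{c(g)}(R_g) = ψ_{c(g)}(R_{c(g)}) ∩ β_g(ψ_{d(g)}(R_{d(g)}))` -/
  image_ideal : ∀ {e f : G} (g : e ⟶ f),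
    {t : T | ∃ a : α.ideal (𝟙 f), (a : R) ∈ α.ideal g ∧ (ψ f a : T) = t} =
      {t : T | ∃ a : α.ideal (𝟙 f), (ψ f a : T) = t} ∩
        {t : T | ∃ a : α.ideal (𝟙 e), hβ.hom g (ψ e a) = t}
  /-- `β_g(ψ_{d(g)}(a)) = ψ_{c(g)}(α_g(a))` for `a ∈ R_{g⁻¹}` -/
  hom_apply : ∀ {e f : G} (g : e ⟶ f) (a : α.ideal (Groupoid.inv g)),
    hβ.hom g (ψ e ⟨a, α.ideal_le (Groupoid.inv g) a.2⟩) =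
      ψ f ⟨α.map g a, α.ideal_le g (α.map g a).2⟩
  /-- `T_g = ∑_{c(h) = c(g)} β_h(ψ_{d(h)}(R_{d(h)}))`, a sum of additive subgroups -/
  ideal_eq : ∀ {e f : G} (g : e ⟶ f),
    (β.ideal g).toAddSubgroup =
      ⨆ (d : G) (h : d ⟶ f), ((hβ.hom h).comp (ψ d)).range.toAddSubgroup

/-- `β` is a globalization of `α`: a global action, together with ring monomorphisms
`ψ_e : R_e → T_e` as above. -/
def IsGlobalization (α : PartialGroupoidAction G R) (β : PartialGroupoidAction G T) : Prop :=
  ∃ (hβ : β.IsGlobal) (ψ : ∀ e : G, α.ideal (𝟙 e) →ₙ+* β.ideal (𝟙 e)),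
    IsGlobalizationVia α β hβ ψ

end PartialGroupoidAction

/-! Suppose a ring is a sum of ideals, each a ring with identity. It satisfies a one-sided chain
condition exactly when every one of these ideals does and finitely many of them already span
(`isLeftNoetherian_iff`, `isLeftArtinian_iff`; the right-handed versions pass to the opposite ring).

This criterion is used twice. `R` is covered by the `R_e`, finite in number since `G` has finitely
many objects. `T` is covered by the translates `β_h(ψ_d(R_d))`, each a copy of some `R_e`, so both
covers impose the same conditions on the pieces. What remains for `T` is a finite subcover by
translates, and `exists_rangeSum_eq_top_iff` identifies its existence with finite type. -/

/-! ### Chain conditions for rings covered by ideals with identity -/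

section UnitalIdealCover

open MulOpposite

/-- A family of injective ring homomorphisms `f i : S i → T` from rings with identity onto ideals
of `T` that together span `T`. -/
structure IsUnitalIdealCover {ι : Type*} {S : ι → Type*} [∀ i, NonUnitalRing (S i)] {T : Type*}
    [NonUnitalRing T] (f : ∀ i, S i →ₙ+* T) : Prop where
  injective : ∀ i, Function.Injective (f i)
  mul_mem_range : ∀ i (t : T) (x : S i), t * f i x ∈ (f i).range ∧ f i x * t ∈ (f i).range
  exists_one : ∀ i, ∃ u : S i, ∀ x, u * x = x ∧ x * u = x
  iSup_range : ⨆ i, (f i).range.toAddSubgroup = ⊤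

/-- Right ideals of `T` are left ideals of the opposite ring. -/
def NURightIdeal.opEquiv (T : Type*) [NonUnitalRing T] :
    NURightIdeal T ≃o NULeftIdeal Tᵐᵒᵖ where
  toFun N := ⟨N.1.comap (opAddEquiv (α := T)).symm.toAddMonoidHom,
    fun r n hn => N.2 r.unop n.unop hn⟩
  invFun N := ⟨N.1.comap (opAddEquiv (α := T)).toAddMonoidHom,
    fun r n hn => N.2 (op r) (op n) hn⟩
  left_inv N := by ext; rfl
  right_inv N := by ext; rfl
  map_rel_iff' {M N} := ⟨fun h x hx => h (x := op x) hx, fun h x hx => h (x := x.unop) hx⟩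

theorem isRightNoetherian_iff_op (T : Type*) [NonUnitalRing T] :
    IsRightNoetherian T ↔ IsLeftNoetherian Tᵐᵒᵖ :=
  ⟨fun h => haveI : WellFoundedGT (NURightIdeal T) := h
    (NURightIdeal.opEquiv T).symm.strictMono.wellFoundedGT,
  fun h => haveI : WellFoundedGT (NULeftIdeal Tᵐᵒᵖ) := h
    (NURightIdeal.opEquiv T).strictMono.wellFoundedGT⟩

theorem isRightArtinian_iff_op (T : Type*) [NonUnitalRing T] :
    IsRightArtinian T ↔ IsLeftArtinian Tᵐᵒᵖ :=
  ⟨fun h => haveI : WellFoundedLT (NURightIdeal T) := h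
    (NURightIdeal.opEquiv T).symm.strictMono.wellFoundedLT,
  fun h => haveI : WellFoundedLT (NULeftIdeal Tᵐᵒᵖ) := h
    (NURightIdeal.opEquiv T).strictMono.wellFoundedLT⟩

variable {ι : Type*} {S : ι → Type*} [∀ i, NonUnitalRing (S i)] {T : Type*} [NonUnitalRing T]

theorem map_opAddEquiv_range {S : Type*} [NonUnitalRing S] (f : S →ₙ+* T) :
    f.range.toAddSubgroup.map (opAddEquiv (α := T)).toAddMonoidHom =
      (NonUnitalRingHom.op f).range.toAddSubgroup := by
  ext x
  constructor
  · rintro ⟨_, ⟨y, rfl⟩, rfl⟩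
    exact ⟨op y, rfl⟩
  · rintro ⟨y, rfl⟩
    exact ⟨_, ⟨y.unop, rfl⟩, rfl⟩

/-- The predicate `p` is `True` for the whole cover and membership for a finite subcover. -/
theorem iSup_range_op_eq_top_iff (f : ∀ i, S i →ₙ+* T) (p : ι → Prop) :
    ⨆ (i) (_ : p i), (NonUnitalRingHom.op (f i)).range.toAddSubgroup = ⊤ ↔
      ⨆ (i) (_ : p i), (f i).range.toAddSubgroup = ⊤ := by
  simp_rw [← map_opAddEquiv_range, ← AddSubgroup.map_iSup]
  rw [← AddSubgroup.map_top_of_surjective (opAddEquiv (α := T)).toAddMonoidHom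
    (opAddEquiv (α := T)).surjective]
  exact (AddSubgroup.map_injective (opAddEquiv (α := T)).injective).eq_iff

/-- The sum of the ranges of the `f i` for `i ∈ s`. -/
def rangeSum (f : ∀ i, S i →ₙ+* T) (s : Finset ι) : AddSubgroup T :=
  ⨆ i ∈ s, (f i).range.toAddSubgroup

theorem apply_mem_rangeSum (f : ∀ i, S i →ₙ+* T) {s : Finset ι} {i : ι} (hi : i ∈ s) (x : S i) :
    f i x ∈ rangeSum f s :=
  le_iSup₂ (f := fun i (_ : i ∈ s) => (f i).range.toAddSubgroup) i hi ⟨x, rfl⟩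

theorem rangeSum_le_iff {f : ∀ i, S i →ₙ+* T} {s : Finset ι} {K : AddSubgroup T} :
    rangeSum f s ≤ K ↔ ∀ i ∈ s, ∀ x, f i x ∈ K := by
  rw [rangeSum, iSup₂_le_iff]
  exact forall₂_congr fun i _ => ⟨fun h x => h ⟨x, rfl⟩, by rintro h _ ⟨x, rfl⟩; exact h x⟩

theorem rangeSum_mono (f : ∀ i, S i →ₙ+* T) {s t : Finset ι} (h : s ⊆ t) :
    rangeSum f s ≤ rangeSum f t :=
  rangeSum_le_iff.2 fun _ hi x => apply_mem_rangeSum f (h hi) x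

namespace IsUnitalIdealCover

variable {f : ∀ i, S i →ₙ+* T}

protected theorem op (hf : IsUnitalIdealCover f) :
    IsUnitalIdealCover fun i => NonUnitalRingHom.op (f i) where
  injective i x y h := unop_injective (hf.injective i (congrArg unop h))
  mul_mem_range i t x := by
    obtain ⟨⟨y, hy⟩, ⟨z, hz⟩⟩ := hf.mul_mem_range i t.unop x.unop
    exact ⟨⟨op z, congrArg op hz⟩, ⟨op y, congrArg op hy⟩⟩
  exists_one i := by
    obtain ⟨u, hu⟩ := hf.exists_one i
    exact ⟨op u, fun x => ⟨congrArg op (hu x.unop).2, congrArg op (hu x.unop).1⟩⟩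
  iSup_range := by
    simpa using (iSup_range_op_eq_top_iff f fun _ => True).2 (by simpa using hf.iSup_range)

theorem mul_mem_rangeSum (hf : IsUnitalIdealCover f) {s : Finset ι} (t : T) {x : T}
    (hx : x ∈ rangeSum f s) : t * x ∈ rangeSum f s ∧ x * t ∈ rangeSum f s := by
  constructor
  · refine (rangeSum_le_iff (K := (rangeSum f s).comap (AddMonoidHom.mulLeft t))).2
      (fun i hi y => ?_) hx
    obtain ⟨z, hz⟩ := (hf.mul_mem_range i t y).1
    exact (hz ▸ apply_mem_rangeSum f hi z : t * f i y ∈ rangeSum f s)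
  · refine (rangeSum_le_iff (K := (rangeSum f s).comap (AddMonoidHom.mulRight t))).2
      (fun i hi y => ?_) hx
    obtain ⟨z, hz⟩ := (hf.mul_mem_range i t y).2
    exact (hz ▸ apply_mem_rangeSum f hi z : f i y * t ∈ rangeSum f s)

/-- Left identities `u`, `v` of two ideals combine to `u + v - uv`, formally `1 - (1 - u)(1 - v)`,
for their sum. -/
theorem exists_one_rangeSum (hf : IsUnitalIdealCover f) (s : Finset ι) :
    ∃ u ∈ rangeSum f s, ∀ x ∈ rangeSum f s, u * x = x := by
  classical
  induction s using Finset.induction_on with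
  | empty => exact ⟨0, zero_mem _, fun x hx => by simp_all [rangeSum]⟩
  | insert i s hi ih =>
    obtain ⟨u, hus, hu⟩ := ih
    obtain ⟨v, hv⟩ := hf.exists_one i
    have hvs := apply_mem_rangeSum f (Finset.mem_insert_self i s) v
    have hus' := rangeSum_mono f (Finset.subset_insert i s) hus
    refine ⟨u + f i v - u * f i v,
      sub_mem (add_mem hus' hvs) (hf.mul_mem_rangeSum _ hvs).1, fun x hx => ?_⟩
    refine (rangeSum_le_iff (K := (AddMonoidHom.mulLeft (u + f i v - u * f i v)).eqLocus
      (AddMonoidHom.id T))).2 (fun j hj y => ?_) hx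
    change (u + f i v - u * f i v) * f j y = f j y
    rw [sub_mul, add_mul, mul_assoc]
    rcases Finset.mem_insert.1 hj with rfl | hj
    · rw [← map_mul, (hv y).1]; abel
    · have hy := apply_mem_rangeSum f hj y
      rw [hu _ hy, hu _ (hf.mul_mem_rangeSum _ hy).1]; abel

/-- The preimage of a left ideal under `f i`. -/
def comapLeftIdeal (f : ∀ i, S i →ₙ+* T) (i : ι) (N : NULeftIdeal T) : NULeftIdeal (S i) :=
  ⟨N.1.comap (f i).toAddMonoidHom, fun r n hn => by
    have h : f i (r * n) ∈ N.1 := by rw [map_mul]; exact N.2 (f i r) (f i n) hn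
    exact h⟩

/-- The image of a left ideal under `f i`. -/
def mapLeftIdeal (hf : IsUnitalIdealCover f) (i : ι) (N : NULeftIdeal (S i)) : NULeftIdeal T :=
  ⟨N.1.map (f i).toAddMonoidHom, by
    rintro r _ ⟨n, hn, rfl⟩
    -- Since `r * f i n = (r * f i u) * f i n`, multiplication by `r` acts on the image as an
    -- element of the range.
    obtain ⟨u, hu⟩ := hf.exists_one i
    obtain ⟨z, hz⟩ := (hf.mul_mem_range i r u).1
    refine ⟨z * n, N.2 z n hn, ?_⟩
    change f i (z * n) = r * f i n
    change f i z = r * f i u at hz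
    rw [map_mul, hz, mul_assoc, ← map_mul, (hu n).1]⟩

theorem mapLeftIdeal_strictMono (hf : IsUnitalIdealCover f) (i : ι) :
    StrictMono (hf.mapLeftIdeal i) := by
  refine Monotone.strictMono_of_injective (fun M N h => ?_) fun M N h => ?_
  · exact AddSubgroup.map_mono (show M.1 ≤ N.1 from h)
  · exact Subtype.ext (AddSubgroup.map_injective (f := (f i).toAddMonoidHom) (hf.injective i)
      (congrArg Subtype.val h))

/-- A left ideal is determined by its traces on a finite cover: with `u` a left identity of `T`, `x
= u * x` is a sum of terms `f i y * x = f i y * (f i v * x)`, where `v` is the identity of `S i` and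
`f i v * x` lies in the trace. -/
theorem comapLeftIdeal_strictMono (hf : IsUnitalIdealCover f) {s : Finset ι}
    (hs : rangeSum f s = ⊤) :
    StrictMono fun (N : NULeftIdeal T) (i : s) => comapLeftIdeal f i N := by
  intro M N h
  refine lt_of_le_not_ge (fun i x hx => h.le hx) fun hle => h.not_ge fun x hx => ?_
  obtain ⟨u, hu, hux⟩ := hf.exists_one_rangeSum s
  rw [← hux x (hs ▸ AddSubgroup.mem_top x)]
  refine (rangeSum_le_iff (K := M.1.comap (AddMonoidHom.mulRight x))).2 (fun i hi y => ?_) hu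
  change f i y * x ∈ M.1
  obtain ⟨v, hv⟩ := hf.exists_one i
  obtain ⟨z, hz⟩ := (hf.mul_mem_range i x v).2
  change f i z = f i v * x at hz
  have hzM : f i z ∈ M.1 := hle ⟨i, hi⟩ (show f i z ∈ N.1 from hz ▸ N.2 _ _ hx)
  rw [← (hv y).2, map_mul, mul_assoc, ← hz]
  exact M.2 _ _ hzM

theorem eq_top_of_forall_mem (hf : IsUnitalIdealCover f) {s : Finset ι}
    (h : ∀ i x, f i x ∈ rangeSum f s) : rangeSum f s = ⊤ := by
  rw [eq_top_iff, ← hf.iSup_range, iSup_le_iff]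
  rintro i _ ⟨x, rfl⟩
  exact h i x

theorem isLeftNoetherian_iff (hf : IsUnitalIdealCover f) :
    IsLeftNoetherian T ↔
      (∀ i, IsLeftNoetherian (S i)) ∧ ∃ s : Finset ι, rangeSum f s = ⊤ := by
  classical
  constructor
  · intro (h : WellFoundedGT (NULeftIdeal T))
    refine ⟨fun i => (hf.mapLeftIdeal_strictMono i).wellFoundedGT, ?_⟩
    let F : Finset ι → NULeftIdeal T := fun s =>
      ⟨rangeSum f s, fun r _ hn => (hf.mul_mem_rangeSum r hn).1⟩
    -- A maximal finite sum absorbs every further range.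
    obtain ⟨_, ⟨s, rfl⟩, hs⟩ := h.wf.has_min (Set.range F) ⟨_, ∅, rfl⟩
    refine ⟨s, hf.eq_top_of_forall_mem fun i x => ?_⟩
    by_contra hx
    refine hs (F (insert i s)) ⟨_, rfl⟩ (lt_of_le_not_ge
      (rangeSum_mono f (Finset.subset_insert i s)) fun hle => hx (hle ?_))
    exact apply_mem_rangeSum f (Finset.mem_insert_self i s) x
  · rintro ⟨h, s, hs⟩
    have (i : s) : WellFoundedLT (NULeftIdeal (S i))ᵒᵈ :=
      haveI : WellFoundedGT (NULeftIdeal (S i)) := h i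
      inferInstance
    have hmono : StrictMono fun (N : (NULeftIdeal T)ᵒᵈ) (i : s) =>
        OrderDual.toDual (comapLeftIdeal f i (OrderDual.ofDual N)) :=
      fun _ _ h => hf.comapLeftIdeal_strictMono hs (OrderDual.ofDual_lt_ofDual.2 h)
    exact wellFoundedLT_dual_iff _ |>.1 hmono.wellFoundedLT

/-- The left annihilator of the ranges of the `f i` for `i ∈ s`. -/
def leftAnnihilator (f : ∀ i, S i →ₙ+* T) (s : Finset ι) : NULeftIdeal T :=
  ⟨{ carrier := {t | ∀ i ∈ s, ∀ x, t * f i x = 0}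
     add_mem' := fun ha hb i hi x => by rw [add_mul, ha i hi, hb i hi, add_zero]
     zero_mem' := fun i _ x => zero_mul _
     neg_mem' := fun ha i hi x => by rw [neg_mul, ha i hi, neg_zero] },
    fun r n hn i hi x => by rw [mul_assoc, hn i hi, mul_zero]⟩

/-- Finite sums grow with `s`, so the descending condition is applied to their left annihilators. At
a minimal one, with `u` a left identity of the sum, `f i x - f i x * u` kills the sum, hence also `f
i v` for `v` the identity of `S i`. Thus `f i x = f i x * u * f i v` lies in the sum. -/
theorem isLeftArtinian_iff (hf : IsUnitalIdealCover f) :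
    IsLeftArtinian T ↔
      (∀ i, IsLeftArtinian (S i)) ∧ ∃ s : Finset ι, rangeSum f s = ⊤ := by
  classical
  constructor
  · intro (h : WellFoundedLT (NULeftIdeal T))
    refine ⟨fun i => (hf.mapLeftIdeal_strictMono i).wellFoundedLT, ?_⟩
    obtain ⟨_, ⟨s, rfl⟩, hs⟩ := h.wf.has_min (Set.range (leftAnnihilator f)) ⟨_, ∅, rfl⟩
    refine ⟨s, hf.eq_top_of_forall_mem fun i x => ?_⟩
    obtain ⟨u, hu, hux⟩ := hf.exists_one_rangeSum s
    obtain ⟨v, hv⟩ := hf.exists_one i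
    have hmem : f i x - f i x * u ∈ (leftAnnihilator f s).1 := fun j hj y => by
      rw [sub_mul, mul_assoc, hux _ (apply_mem_rangeSum f hj y), sub_self]
    have hle : leftAnnihilator f s ≤ leftAnnihilator f (insert i s) := by
      by_contra hle
      exact hs _ ⟨_, rfl⟩ (lt_of_le_not_ge
        (fun t ht j hj => ht j (Finset.mem_insert_of_mem hj)) hle)
    have h0 := hle hmem i (Finset.mem_insert_self i s) v
    rw [sub_mul, ← map_mul, (hv x).2, sub_eq_zero] at h0
    rw [h0]
    exact (hf.mul_mem_rangeSum _ (hf.mul_mem_rangeSum _ hu).1).2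
  · rintro ⟨h, s, hs⟩
    have (i : s) : WellFoundedLT (NULeftIdeal (S i)) := h i
    exact (hf.comapLeftIdeal_strictMono hs).wellFoundedLT

theorem isRightNoetherian_iff (hf : IsUnitalIdealCover f) :
    IsRightNoetherian T ↔
      (∀ i, IsRightNoetherian (S i)) ∧ ∃ s : Finset ι, rangeSum f s = ⊤ := by
  simp_rw [isRightNoetherian_iff_op, hf.op.isLeftNoetherian_iff]
  exact and_congr Iff.rfl (exists_congr fun s => iSup_range_op_eq_top_iff f (· ∈ s))

theorem isRightArtinian_iff (hf : IsUnitalIdealCover f) :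
    IsRightArtinian T ↔
      (∀ i, IsRightArtinian (S i)) ∧ ∃ s : Finset ι, rangeSum f s = ⊤ := by
  simp_rw [isRightArtinian_iff_op, hf.op.isLeftArtinian_iff]
  exact and_congr Iff.rfl (exists_congr fun s => iSup_range_op_eq_top_iff f (· ∈ s))

end IsUnitalIdealCover

end UnitalIdealCover

/-! ### Object components and global actions -/

namespace PartialGroupoidAction

variable {G : Type u} [Groupoid.{v} G] {R : Type w} [NonUnitalRing R]
  {T : Type w'} [NonUnitalRing T]

theorem iSup_ideal_id (α : PartialGroupoidAction G R) :
    ⨆ e : G, (α.ideal (𝟙 e)).toAddSubgroup = ⊤ := by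
  classical
  refine eq_top_iff.2 fun x _ => ?_
  obtain ⟨d, rfl⟩ := α.isInternal.2 x
  induction d using DirectSum.induction_on with
  | zero => rw [map_zero]; exact zero_mem _
  | of e y =>
    rw [DirectSum.coeAddMonoidHom_of]
    exact le_iSup (fun e : G => (α.ideal (𝟙 e)).toAddSubgroup) e y.2
  | add a b ha hb => rw [map_add]; exact add_mem (ha trivial) (hb trivial)

theorem eq_zero_of_mem_of_mem (α : PartialGroupoidAction G R) {e f : G} (h : e ≠ f) {x : R}
    (hx : x ∈ α.ideal (𝟙 e)) (hy : x ∈ α.ideal (𝟙 f)) : x = 0 := by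
  classical
  have h1 := DFunLike.congr_fun (α.isInternal.1 (a₁ := DirectSum.of _ e ⟨x, hx⟩)
    (a₂ := DirectSum.of _ f ⟨x, hy⟩) (by simp only [DirectSum.coeAddMonoidHom_of])) e
  rw [DirectSum.of_eq_same, DirectSum.of_eq_of_ne _ _ _ h] at h1
  exact congrArg Subtype.val h1

theorem mul_eq_zero_of_ne (α : PartialGroupoidAction G R) {e f : G} (h : e ≠ f) {x y : R}
    (hx : x ∈ α.ideal (𝟙 e)) (hy : y ∈ α.ideal (𝟙 f)) : x * y = 0 :=
  α.eq_zero_of_mem_of_mem h (α.ideal_id_mul_mem e y x hx).2 (α.ideal_id_mul_mem f x y hy).1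

theorem IsUnital.exists_one {α : PartialGroupoidAction G R} (hα : α.IsUnital) (e : G) :
    ∃ u : α.ideal (𝟙 e), ∀ x, u * x = x ∧ x * u = x := by
  by_cases h : α.ideal (𝟙 e) = ⊥
  · have h0 (x : α.ideal (𝟙 e)) : x = 0 := 
    Subtype.ext (NonUnitalSubring.mem_bot.1 (h.le x.2))
    exact ⟨0, fun x => by rw [h0 x, mul_zero]; exact ⟨rfl, rfl⟩⟩
  · obtain ⟨u, hu, hux⟩ := hα (𝟙 e) h
    exact ⟨⟨u, hu⟩, fun x => ⟨Subtype.ext (hux x x.2).1, Subtype.ext (hux x x.2).2⟩⟩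

theorem iSup_range_subtype_ideal_id (α : PartialGroupoidAction G R) :
    ⨆ e : G, (NonUnitalSubringClass.subtype (α.ideal (𝟙 e))).range.toAddSubgroup = ⊤ := by
  rw [← α.iSup_ideal_id]
  congr! with e
  exact NonUnitalSubring.range_subtype _

theorem IsUnital.isUnitalIdealCover_subtype {α : PartialGroupoidAction G R} (hα : α.IsUnital) :
    IsUnitalIdealCover fun e : G => NonUnitalSubringClass.subtype (α.ideal (𝟙 e)) where
  injective _ := Subtype.val_injective
  mul_mem_range e t x :=
    ⟨⟨⟨_, (α.ideal_id_mul_mem e t x x.2).1⟩, rfl⟩, ⟨⟨_, (α.ideal_id_mul_mem e t x x.2).2⟩, rfl⟩⟩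
  exists_one := hα.exists_one
  iSup_range := α.iSup_range_subtype_ideal_id

namespace IsGlobal

variable {β : PartialGroupoidAction G T} (hβ : β.IsGlobal)

/-- `β_g` as a map `T_{d(g)} → T_{c(g)}`. -/
def homId {e f : G} (g : e ⟶ f) : β.ideal (𝟙 e) →ₙ+* β.ideal (𝟙 f) :=
  NonUnitalRingHom.codRestrict (hβ.hom g) (β.ideal (𝟙 f)) fun _ => β.ideal_le g (Subtype.prop _)

theorem homId_homId {d e f : G} (h : d ⟶ e) (g : e ⟶ f) (x : β.ideal (𝟙 d)) :
    hβ.homId g (hβ.homId h x) = hβ.homId (h ≫ g) x :=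
  Subtype.ext (β.map_map h g ⟨x, hβ.ideal_id_le h x.2⟩
    (hβ.ideal_id_le g (β.ideal_le h (Subtype.prop _))))

theorem homId_id {e : G} (x : β.ideal (𝟙 e)) : hβ.homId (𝟙 e) x = x :=
  Subtype.ext (β.map_id e ⟨x, hβ.ideal_id_le (𝟙 e) x.2⟩)

theorem homId_inv_homId {e f : G} (g : e ⟶ f) (x : β.ideal (𝟙 e)) :
    hβ.homId (Groupoid.inv g) (hβ.homId g x) = x := by
  rw [homId_homId, Groupoid.comp_inv, homId_id]

theorem homId_homId_inv {e f : G} (g : e ⟶ f) (x : β.ideal (𝟙 f)) :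
    hβ.homId g (hβ.homId (Groupoid.inv g) x) = x := by
  rw [homId_homId, Groupoid.inv_comp, homId_id]

theorem homId_injective {e f : G} (g : e ⟶ f) : Function.Injective (hβ.homId g) :=
  Function.LeftInverse.injective (hβ.homId_inv_homId g)

end IsGlobal

/-! ### Translates and finite type -/

/-- `β_h ψ_{d(h)} : R_{d(h)} → T`, for a morphism `h` given together with its codomain and
domain. -/
def translate {α : PartialGroupoidAction G R} {β : PartialGroupoidAction G T} (hβ : β.IsGlobal)
    (ψ : ∀ e : G, α.ideal (𝟙 e) →ₙ+* β.ideal (𝟙 e)) (p : Σ f : G, Σ d : G, (d ⟶ f)) :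
    α.ideal (𝟙 p.2.1) →ₙ+* T :=
  (hβ.hom p.2.2).comp (ψ p.2.1)

namespace IsGlobalizationVia

variable {α : PartialGroupoidAction G R} {β : PartialGroupoidAction G T} {hβ : β.IsGlobal}
  {ψ : ∀ e : G, α.ideal (𝟙 e) →ₙ+* β.ideal (𝟙 e)}

/-- Pulling `t` back along `β_{h⁻¹}` reduces this to `ψ_d(R_d)` being an ideal of `T_d`. -/
theorem exists_map_eq_mul (hψ : IsGlobalizationVia α β hβ ψ) {d f : G} (h : d ⟶ f)
    (t : β.ideal (𝟙 f)) (x : α.ideal (𝟙 d)) :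
    (∃ y, hβ.homId h (ψ d y) = t * hβ.homId h (ψ d x)) ∧
      ∃ y, hβ.homId h (ψ d y) = hβ.homId h (ψ d x) * t := by
  obtain ⟨⟨y, hy⟩, ⟨z, hz⟩⟩ :=
    hψ.range_ideal d (hβ.homId (Groupoid.inv h) t) (ψ d x) ⟨x, rfl⟩
  refine ⟨⟨y, ?_⟩, ⟨z, ?_⟩⟩
  · rw [hy, map_mul, hβ.homId_homId_inv]
  · rw [hz, map_mul, hβ.homId_homId_inv]

theorem isUnitalIdealCover_translate (hψ : IsGlobalizationVia α β hβ ψ) (hα : α.IsUnital) :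
    IsUnitalIdealCover (translate hβ ψ) where
  injective p x y h := hψ.injective _ (hβ.homId_injective p.2.2 (Subtype.ext h))
  mul_mem_range := by
    rintro ⟨f, d, h⟩ t x
    -- Multiplying an arbitrary `t` by the image of the identity of `R_d` moves it into `T_f`
    -- without changing its products with the translate.
    obtain ⟨u, hu⟩ := hα.exists_one d
    have hmem := β.ideal_id_mul_mem f t _ (hβ.homId h (ψ d u)).2
    obtain ⟨y, hy⟩ := (hψ.exists_map_eq_mul h ⟨_, hmem.1⟩ x).1
    obtain ⟨z, hz⟩ := (hψ.exists_map_eq_mul h ⟨_, hmem.2⟩ x).2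
    have hux : hβ.homId h (ψ d u) * hβ.homId h (ψ d x) = hβ.homId h (ψ d x) := by
      rw [← map_mul, ← map_mul, (hu x).1]
    have hxu : hβ.homId h (ψ d x) * hβ.homId h (ψ d u) = hβ.homId h (ψ d x) := by
      rw [← map_mul, ← map_mul, (hu x).2]
    refine ⟨⟨y, (congrArg Subtype.val hy).trans ?_⟩, ⟨z, (congrArg Subtype.val hz).trans ?_⟩⟩
    · exact (mul_assoc _ _ _).trans (congrArg (t * ·) (congrArg Subtype.val hux))
    · exact (mul_assoc _ _ _).symm.trans (congrArg (· * t) (congrArg Subtype.val hxu))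
  exists_one p := hα.exists_one p.2.1
  iSup_range := by
    rw [← β.iSup_ideal_id, iSup_sigma]
    refine iSup_congr fun f => ?_
    rw [iSup_sigma, hψ.ideal_eq (𝟙 f)]
    rfl

theorem mem_ideal_of_homId_eq (hψ : IsGlobalizationVia α β hβ ψ) {e f : G} (g : e ⟶ f)
    {a : α.ideal (𝟙 f)} {c : α.ideal (𝟙 e)} (h : hβ.homId g (ψ e c) = ψ f a) :
    (a : R) ∈ α.ideal g := by
  obtain ⟨b, hb, hba⟩ := (hψ.image_ideal g).ge ⟨⟨a, rfl⟩, ⟨c, congrArg Subtype.val h⟩⟩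
  rwa [hψ.injective f (Subtype.ext hba)] at hb

theorem exists_homId_eq_of_mem_ideal (hψ : IsGlobalizationVia α β hβ ψ) {e f : G} (g : e ⟶ f)
    {a : α.ideal (𝟙 f)} (h : (a : R) ∈ α.ideal g) : ∃ c, hβ.homId g (ψ e c) = ψ f a := by
  obtain ⟨-, c, hc⟩ := (hψ.image_ideal g).le ⟨a, h, rfl⟩
  exact ⟨c, Subtype.ext hc⟩

/-- For the object `e`, the members of `s` with codomain `e` suffice: `v`, the identity of `R_f`
carried into `T_e`, annihilates the translates in other components. -/
theorem isOfFiniteType_of_rangeSum_eq_top (hψ : IsGlobalizationVia α β hβ ψ) (hα : α.IsUnital)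
    {s : Finset (Σ f : G, Σ d : G, (d ⟶ f))} (hs : rangeSum (translate hβ ψ) s = ⊤) :
    α.IsOfFiniteType := by
  classical
  intro e
  have hinj : Function.Injective
      (Sigma.mk (β := fun f : G => Σ d : G, (d ⟶ f)) e) := sigma_mk_injective
  refine ⟨s.preimage _ hinj.injOn, fun {f} g => ?_⟩
  set B : AddSubgroup R := ⨆ p ∈ s.preimage _ hinj.injOn, (α.ideal (p.2 ≫ g)).toAddSubgroup
  refine le_antisymm (fun a ha => ?_) (iSup₂_le fun p _ => α.ideal_le (p.2 ≫ g))
  obtain ⟨u, hu⟩ := hα.exists_one f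
  let v : β.ideal (𝟙 e) := hβ.homId (Groupoid.inv g) (ψ f u)
  -- every `t : T` satisfies `β_g (t v) ∈ ψ_f B`
  let K : AddSubgroup T :=
    { carrier := {t | ∃ b : α.ideal (𝟙 f), (b : R) ∈ B ∧
        ψ f b = hβ.homId g ⟨t * v, (β.ideal_id_mul_mem e t v v.2).1⟩}
      add_mem' := by
        rintro x y ⟨b, hb, hbx⟩ ⟨c, hc, hcy⟩
        refine ⟨b + c, add_mem hb hc, ?_⟩
        rw [map_add, hbx, hcy, ← map_add]
        exact congrArg _ (Subtype.ext (add_mul _ _ _).symm)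
      zero_mem' := by
        refine ⟨0, zero_mem _, ?_⟩
        rw [map_zero, ← map_zero (hβ.homId g)]
        exact congrArg _ (Subtype.ext (zero_mul _).symm)
      neg_mem' := by
        rintro x ⟨b, hb, hbx⟩
        refine ⟨-b, neg_mem hb, ?_⟩
        rw [map_neg, hbx, ← map_neg]
        exact congrArg _ (Subtype.ext (neg_mul _ _).symm) }
  have hK : rangeSum (translate hβ ψ) s ≤ K := by
    rw [rangeSum_le_iff]
    rintro ⟨e', d, h⟩ hp x
    by_cases he : e' = e
    · subst he
      -- For `t = β_h(ψ_d(x))`, `y` puts `β_g(tv)` in `β_{gh}(ψ_d(R_d))` and `z` puts it in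
      -- `ψ_f(R_f)`; the intersection is `ψ_f(R_{gh})`.
      obtain ⟨y, hy⟩ := (hψ.exists_map_eq_mul h v x).2
      obtain ⟨z, hz⟩ := (hψ.exists_map_eq_mul (Groupoid.inv g) (hβ.homId h (ψ d x)) u).1
      have hzψ : ψ f z = hβ.homId g (hβ.homId h (ψ d x) * v) := by
        rw [← hz, hβ.homId_homId_inv]
      refine ⟨z, ?_, hzψ⟩
      refine le_iSup₂ (f := fun (p : Σ d : G, (d ⟶ e')) (_ : p ∈ s.preimage _ hinj.injOn) =>
        (α.ideal (p.2 ≫ g)).toAddSubgroup) ⟨d, h⟩ (Finset.mem_preimage.2 hp) ?_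
      exact hψ.mem_ideal_of_homId_eq (h ≫ g) (c := y) (by
        rw [← hβ.homId_homId, hy, hzψ])
    · refine ⟨0, zero_mem _, ?_⟩
      rw [map_zero, ← map_zero (hβ.homId g)]
      exact congrArg _ (Subtype.ext
        (β.mul_eq_zero_of_ne he (hβ.homId h (ψ d x)).2 v.2).symm)
  -- Take `t = β_{g⁻¹}(ψ_f(a))`: then `tv = t`, so `β_g(tv) = ψ_f(a)`.
  obtain ⟨b, hb, hba⟩ :=
    hK (hs ▸ AddSubgroup.mem_top (hβ.homId (Groupoid.inv g) (ψ f ⟨a, ha⟩) : T))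
  have hmul : hβ.homId (Groupoid.inv g) (ψ f ⟨a, ha⟩) * v =
      hβ.homId (Groupoid.inv g) (ψ f ⟨a, ha⟩) := by
    rw [← map_mul, ← map_mul, (hu _).2]
  have hab : b = ⟨a, ha⟩ := hψ.injective f
    (hba.trans ((congrArg (hβ.homId g) hmul).trans (hβ.homId_homId_inv g _)))
  rwa [hab] at hb

/-- For `h : d ⟶ f`, finite type at `f` applied to `h⁻¹` gives `R_d` as the sum of the `R_{h⁻¹p}`
with `p ∈ s f`. On such a piece `ψ_d(x) = β_{h⁻¹p}(ψ(c))`, so `β_h(ψ_d(x)) = β_p(ψ(c))`: the chosen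
`p` absorb every translate into `T_f`. -/
theorem exists_rangeSum_eq_top [Finite G] (hψ : IsGlobalizationVia α β hβ ψ) (hα : α.IsUnital)
    (h : α.IsOfFiniteType) :
    ∃ s : Finset (Σ f : G, Σ d : G, (d ⟶ f)), rangeSum (translate hβ ψ) s = ⊤ := by
  classical
  have := Fintype.ofFinite G
  choose s hs using h
  refine ⟨Finset.univ.sigma s, (hψ.isUnitalIdealCover_translate hα).eq_top_of_forall_mem ?_⟩
  rintro ⟨f, d, h⟩ ⟨a, ha⟩
  let K : AddSubgroup (α.ideal (𝟙 d)) := (rangeSum (translate hβ ψ) (Finset.univ.sigma s)).comap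
    (translate hβ ψ ⟨f, d, h⟩).toAddMonoidHom
  have hle : (α.ideal (𝟙 d)).toAddSubgroup ≤
      K.map (NonUnitalSubringClass.subtype (α.ideal (𝟙 d))).toAddMonoidHom := by
    rw [hs f (Groupoid.inv h)]
    refine iSup₂_le fun p hp x hx => ?_
    refine ⟨⟨x, α.ideal_le _ hx⟩, ?_, rfl⟩
    obtain ⟨c, hc⟩ := hψ.exists_homId_eq_of_mem_ideal (p.2 ≫ Groupoid.inv h)
      (a := ⟨x, α.ideal_le _ hx⟩) hx
    rw [← hβ.homId_homId] at hc
    have hmem := apply_mem_rangeSum (translate hβ ψ) (i := ⟨f, p⟩)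
      (Finset.mem_sigma.2 ⟨Finset.mem_univ f, hp⟩) c
    have heq : hβ.homId h (ψ d ⟨x, α.ideal_le _ hx⟩) = hβ.homId p.2 (ψ p.1 c) := by
      rw [← hc, hβ.homId_homId_inv]
    change translate hβ ψ ⟨f, d, h⟩ ⟨x, α.ideal_le _ hx⟩ ∈ rangeSum (translate hβ ψ) _
    rwa [show translate hβ ψ ⟨f, d, h⟩ ⟨x, α.ideal_le _ hx⟩ = translate hβ ψ ⟨f, p⟩ c from
      congrArg Subtype.val heq]
  obtain ⟨b, hb, rfl⟩ := hle ha
  exact hb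

theorem exists_rangeSum_eq_top_iff [Finite G] (hψ : IsGlobalizationVia α β hβ ψ)
    (hα : α.IsUnital) :
    (∃ s : Finset (Σ f : G, Σ d : G, (d ⟶ f)), rangeSum (translate hβ ψ) s = ⊤) ↔
      α.IsOfFiniteType :=
  ⟨fun ⟨_, hs⟩ => hψ.isOfFiniteType_of_rangeSum_eq_top hα hs, hψ.exists_rangeSum_eq_top hα⟩

end IsGlobalizationVia

theorem exists_rangeSum_subtype_ideal_id [Finite G] (α : PartialGroupoidAction G R) :
    ∃ s : Finset G,
      rangeSum (fun e : G => NonUnitalSubringClass.subtype (α.ideal (𝟙 e))) s = ⊤ := by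
  have := Fintype.ofFinite G
  refine ⟨Finset.univ, ?_⟩
  simpa [rangeSum] using α.iSup_range_subtype_ideal_id

end PartialGroupoidAction

theorem forall_sigma_hom_iff {G : Type*} [Groupoid G] {P : G → Prop} :
    (∀ p : Σ f : G, Σ d : G, (d ⟶ f), P p.2.1) ↔ ∀ e, P e :=
  ⟨fun h e => h ⟨e, e, 𝟙 e⟩, fun h p => h p.2.1⟩

theorem mainTheorem11 {G : Type u} [Groupoid.{v} G] [Finite G]
    {R : Type w} [NonUnitalRing R] {T : Type w'} [NonUnitalRing T]
    (α : PartialGroupoidAction G R) (β : PartialGroupoidAction G T)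
    (hα : α.IsUnital) (hβ : PartialGroupoidAction.IsGlobalization α β) :
    (IsRightNoetherian T ↔ IsRightNoetherian R ∧ α.IsOfFiniteType) ∧
    (IsLeftNoetherian T ↔ IsLeftNoetherian R ∧ α.IsOfFiniteType) ∧
    (IsRightArtinian T ↔ IsRightArtinian R ∧ α.IsOfFiniteType) ∧
    (IsLeftArtinian T ↔ IsLeftArtinian R ∧ α.IsOfFiniteType) := by
  obtain ⟨hβ, ψ, hψ⟩ := hβ
  have hT := hψ.isUnitalIdealCover_translate hα
  have hR := hα.isUnitalIdealCover_subtype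
  have hs := α.exists_rangeSum_subtype_ideal_id
  rw [← hψ.exists_rangeSum_eq_top_iff hα]
  refine ⟨?_, ?_, ?_, ?_⟩
  · rw [hT.isRightNoetherian_iff, hR.isRightNoetherian_iff, and_iff_left hs]
    exact and_congr_left' (forall_sigma_hom_iff (P := fun e => IsRightNoetherian (α.ideal (𝟙 e))))
  · rw [hT.isLeftNoetherian_iff, hR.isLeftNoetherian_iff, and_iff_left hs]
    exact and_congr_left' (forall_sigma_hom_iff (P := fun e => IsLeftNoetherian (α.ideal (𝟙 e))))
  · rw [hT.isRightArtinian_iff, hR.isRightArtinian_iff, and_iff_left hs]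
    exact and_congr_left' (forall_sigma_hom_iff (P := fun e => IsRightArtinian (α.ideal (𝟙 e))))
  · rw [hT.isLeftArtinian_iff, hR.isLeftArtinian_iff, and_iff_left hs]
    exact and_congr_left' (forall_sigma_hom_iff (P := fun e => IsLeftArtinian (α.ideal (𝟙 e))))
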